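/- Let $\mathbb{D}^2=\{(z_1,z_2)\in\mathbb{C}^2: |z_1|\le 1,\ |z_2|\le 1\}$ be the closed bidisc, $\mathbb{T}^2=\{(z_1,z_2): |z_1|=|z_2|=1\}$ the torus, and let $\mathbb{A}^2$ be the bidisc algebra, i.e. the Banach algebra (with the supremum norm) of all complex-valued functions continuous on $\mathbb{D}^2$ and analytic in the open bidisc. Let $p,q\ge 1$ be integers, let $\alpha_1$ be a primitive $p$-th root of unity and $\alpha_2$ a primitive $q$-th root of unity, put $m=\operatorname{lcm}(p,q)$ and $\Phi(z_1,z_2)=(\alpha_1z_1,\alpha_2z_2)$. Let $w\in\mathbb{A}^2$ be arbitrary, let $T:\mathbb{A}^2\to\mathbb{A}^2$ be the weighted composition operator $Tf=w\cdot(f\circ\Phi)$, and let $w_m(t)=w(t)\,w(\Phi(t))\cdots w(\Phi^{m-1}(t))$ for $t \in \mathbb{D}^2$. A bounded operator $S$ on a Banach space is called upper semi-Fredholm if its image is closed and its kernel is finite-dimensional, lower semi-Fredholm if its image has finite codimension, and semi-Fredholm if it is upper or lower semi-Fredholm. Let $\sigma(T)$ be the spectrum of $T$; let $\sigma_{a.p.}(T)$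 be the set of $\lambda\in\mathbb{C}$ for which there are $f_n\in\mathbb{A}^2$ with $\|f_n\|=1$ and $Tf_n-\lambda f_n\to 0$; let $\sigma_{lsf}(T)$ (respectively $\sigma_{sf}(T)$) be the set of $\lambda\in\mathbb{C}$ for which $\lambda I-T$ is not lower semi-Fredholm (respectively not semi-Fredholm). Then \begin{enumerate} \item $\sigma(T)=\sigma_{lsf}(T)=\{\lambda\in\mathbb{C}: \lambda^m=w_m(t)\text{ for some }t\in\mathbb{D}^2\}$; \item $\sigma_{a.p.}(T)=\sigma_{sf}(T)=\{\lambda\in\mathbb{C}: \lambda^m=w_m(t)\text{ for some }t\in\mathbb{T}^2\}$. \end{enumerate} -/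

import Mathlib

open Filter Topology

noncomputable section

namespace Bidisc

/-- The closed unit bidisc `𝔻²`. -/
def closedBidisc : Set (ℂ × ℂ) := {z | ‖z.1‖ ≤ 1 ∧ ‖z.2‖ ≤ 1}

/-- The open unit bidisc `𝕌²`. -/
def openBidisc : Set (ℂ × ℂ) := {z | ‖z.1‖ < 1 ∧ ‖z.2‖ < 1}

/-- The torus `𝕋²`, as a subset of the closed bidisc. -/
def torus : Set closedBidisc := {t | ‖t.1.1‖ = 1 ∧ ‖t.1.2‖ = 1}

instance instCompactSpaceClosedBidisc : CompactSpace closedBidisc := by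
  have h : closedBidisc = Metric.closedBall (0 : ℂ) 1 ×ˢ Metric.closedBall (0 : ℂ) 1 := by
    ext z
    simp [closedBidisc]
  rw [← isCompact_iff_compactSpace, h]
  exact (isCompact_closedBall _ _).prod (isCompact_closedBall _ _)

/-- The bidisc algebra `𝔸²` with the supremum norm: the continuous functions on the closed
bidisc that are holomorphic in the open bidisc. -/
def bidiscAlgebra : Subalgebra ℂ C(closedBidisc, ℂ) where
  carrier := {f | ∃ F : ℂ × ℂ → ℂ, DifferentiableOn ℂ F openBidisc ∧
    ∀ z : closedBidisc, F z = f z}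
  mul_mem' := by
    rintro f g ⟨F, hF, hFf⟩ ⟨G, hG, hGg⟩
    exact ⟨fun z => F z * G z, hF.mul hG, fun z => by simp [hFf, hGg]⟩
  add_mem' := by
    rintro f g ⟨F, hF, hFf⟩ ⟨G, hG, hGg⟩
    exact ⟨fun z => F z + G z, hF.add hG, fun z => by simp [hFf, hGg]⟩
  algebraMap_mem' c := ⟨fun _ => c, differentiableOn_const c, fun _ => by simp⟩

/-- The map `Φ (z₁, z₂) = (α₁ z₁, α₂ z₂)` of the closed bidisc into itself. -/
def rotation (α₁ α₂ : Circle) : C(closedBidisc, closedBidisc) where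
  toFun z := ⟨((α₁ : ℂ) * z.1.1, (α₂ : ℂ) * z.1.2), by
    simpa [closedBidisc, Circle.norm_coe] using z.2⟩
  continuous_toFun := by fun_prop

/-- The composition `f ∘ Φ`, as an element of the bidisc algebra. -/
def compRotation (α₁ α₂ : Circle) (f : bidiscAlgebra) : bidiscAlgebra :=
  ⟨(f : C(closedBidisc, ℂ)).comp (rotation α₁ α₂), by
    obtain ⟨F, hF, hFf⟩ := f.2
    refine ⟨fun z => F ((α₁ : ℂ) * z.1, (α₂ : ℂ) * z.2), ?_, fun z => ?_⟩
    · refine hF.comp (f := fun z : ℂ × ℂ => ((α₁ : ℂ) * z.1, (α₂ : ℂ) * z.2))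
        (Differentiable.differentiableOn (by fun_prop)) ?_
      intro z hz
      simpa [openBidisc, Circle.norm_coe] using hz
    · exact hFf (rotation α₁ α₂ z)⟩

/-- The weighted composition operator `T f = w · (f ∘ Φ)` on the bidisc algebra. -/
def weightedRotation (α₁ α₂ : Circle) (w : bidiscAlgebra) :
    bidiscAlgebra →L[ℂ] bidiscAlgebra :=
  LinearMap.mkContinuous
    { toFun := fun f => w * compRotation α₁ α₂ f
      map_add' := fun f g => by
        ext z
        exact mul_add _ _ _
      map_smul' := fun c f => by
        ext z
        exact mul_left_comm _ _ _ }
    ‖w‖ (fun f => by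
      refine (norm_mul_le _ _).trans (mul_le_mul_of_nonneg_left ?_ (norm_nonneg _))
      refine (ContinuousMap.norm_le _ (norm_nonneg _)).2 fun z => ?_
      exact ContinuousMap.norm_coe_le_norm (f : C(closedBidisc, ℂ)) (rotation α₁ α₂ z))

/-- `w_n (t) = w (t) w (φ t) ⋯ w (φ^{n-1} t)`. -/
def weightProduct {K : Type*} (φ : K → K) (w : K → ℂ) (n : ℕ) (t : K) : ℂ :=
  ∏ k ∈ Finset.range n, w (φ^[k] t)

section Spectra

variable {X : Type*} [NormedAddCommGroup X] [NormedSpace ℂ X]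

/-- Upper semi-Fredholm: closed image and finite-dimensional kernel. -/
def IsUpperSemiFredholm (S : X →L[ℂ] X) : Prop :=
  IsClosed (S.range : Set X) ∧ FiniteDimensional ℂ S.ker

/-- Lower semi-Fredholm: image of finite codimension. -/
def IsLowerSemiFredholm (S : X →L[ℂ] X) : Prop :=
  FiniteDimensional ℂ (X ⧸ S.range)

/-- Semi-Fredholm: upper or lower semi-Fredholm. -/
def IsSemiFredholm (S : X →L[ℂ] X) : Prop :=
  IsUpperSemiFredholm S ∨ IsLowerSemiFredholm S

/-- The approximate point spectrum. -/
def approxPointSpectrum (T : X →L[ℂ] X) : Set ℂ :=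
  {μ | ∃ x : ℕ → X, (∀ n, ‖x n‖ = 1) ∧ Tendsto (fun n => T (x n) - μ • x n) atTop (𝓝 0)}

/-- The lower semi-Fredholm spectrum. -/
def lowerSemiFredholmSpectrum (T : X →L[ℂ] X) : Set ℂ :=
  {μ | ¬ IsLowerSemiFredholm (μ • ContinuousLinearMap.id ℂ X - T)}

/-- The semi-Fredholm spectrum. -/
def semiFredholmSpectrum (T : X →L[ℂ] X) : Set ℂ :=
  {μ | ¬ IsSemiFredholm (μ • ContinuousLinearMap.id ℂ X - T)}

end Spectra

end Bidisc

end

open Filter Topology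

noncomputable section

namespace Bidisc

/-! ### Stability and compactness properties of semi-Fredholm operators. -/

section BanachSpaces

variable {X Y : Type*} [NormedAddCommGroup X] [NormedSpace ℂ X] [CompleteSpace X]
  [NormedAddCommGroup Y] [NormedSpace ℂ Y] [CompleteSpace Y]

/-! Put `S = μ - T` and let `R` be the cofactor `∑ μ ^ (m - 1 - i) T ^ i`. Since `Φ ^ m = id`, both
`R S` and `S R` are multiplication by `χ = μ ^ m - w_m`. If `χ` has no zero, dividing by `χ` inverts
`S`; if `χ` has no zero on the torus, the maximum principle makes `S` bounded below.

Suppose `χ` vanishes at a torus point `t`. For `μ ≠ 0` and `g` peaking at `t`, the functions `R (g ^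
n)` are bounded, `S` sends them to `χ g ^ n → 0`, and they converge pointwise to `0` off the orbit
of `t`. Their values at `t` tend to `μ ^ (m - 1) ≠ 0`, because the orbit is free. They thus have no
norm-convergent subsequence, so `S` is not upper semi-Fredholm, and `μ` is an approximate
eigenvalue. For `μ = 0` powers of a peak function suffice (`exists_isSingularSequence`).

If `χ` vanishes anywhere, the range of `S` has infinite codimension (`not_isLowerSemiFredholm`). At
a point of the open bidisc off the axes, with `μ ≠ 0`, this follows because zeros in two variables
are not isolated: the functionals `g ↦ (R g) s`, over infinitely many nearby zeros `s` of `χ`,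
annihilate the range and are independent. Other points reduce to these by moving `μ` and the point
slightly, since being lower semi-Fredholm is an open condition. This fails only when `w_m` vanishes
on an open set; then `w` has infinitely many zeros and `μ = 0`, where every function in the range
vanishes. -/

theorem eventually_surjective_of_surjective (S : X →L[ℂ] Y) (hS : Function.Surjective S) :
    ∀ᶠ S' : X →L[ℂ] Y in 𝓝 S, Function.Surjective S' := by
  obtain ⟨g, hg⟩ := S.exists_nonlinearRightInverse_of_surjective (LinearMap.range_eq_top.2 hS)
  have hpos : (0 : ℝ) < (g.nnnorm : ℝ)⁻¹ / 2 := by positivity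
  filter_upwards [Metric.ball_mem_nhds S hpos] with S' hS' y
  set c : ℝ := (g.nnnorm : ℝ)⁻¹ / 2 with hc
  have happ : ApproximatesLinearOn S' S Set.univ ⟨c, hpos.le⟩ := by
    intro x _ x' _
    rw [← map_sub, ← sub_apply]
    refine ((S' - S).le_opNorm _).trans ?_
    gcongr
    rw [Metric.mem_ball, dist_eq_norm] at hS'
    exact hS'.le
  have hmem : y ∈ Metric.closedBall (S' 0)
      (((g.nnnorm : ℝ)⁻¹ - ((⟨c, hpos.le⟩ : NNReal) : ℝ)) * (‖y‖ / c)) := by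
    have : (g.nnnorm : ℝ)⁻¹ - c = c := by rw [hc]; ring
    rw [map_zero, mem_closedBall_zero_iff]
    change ‖y‖ ≤ ((g.nnnorm : ℝ)⁻¹ - c) * (‖y‖ / c)
    rw [this, mul_div_cancel₀ _ hpos.ne']
  obtain ⟨x, -, hx⟩ := happ.surjOn_closedBall_of_nonlinearRightInverse g (b := 0)
    (ε := ‖y‖ / c) (by positivity) (Set.subset_univ _) hmem
  exact ⟨x, hx⟩

/-- Adjoining a finite-dimensional complement `V` of the range makes `S` surjective on `X × V`.
Surjectivity survives small perturbations, and then `V` still surjects onto the perturbed cokernel.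
-/
theorem IsLowerSemiFredholm.eventually {S : X →L[ℂ] X} (hS : IsLowerSemiFredholm S) :
    ∀ᶠ S' : X →L[ℂ] X in 𝓝 S, IsLowerSemiFredholm S' := by
  obtain ⟨V, hV⟩ := exists_isCompl S.range
  have : FiniteDimensional ℂ (X ⧸ S.range) := hS
  have : FiniteDimensional ℂ V :=
    LinearEquiv.finiteDimensional (Submodule.quotientEquivOfIsCompl _ V hV)
  have hsurj : Function.Surjective (S.coprod V.subtypeL) := by
    intro y
    obtain ⟨_, ⟨x, rfl⟩, v, hv, rfl⟩ :=
      Submodule.mem_sup.1 (hV.sup_eq_top ▸ Submodule.mem_top : y ∈ S.range ⊔ V)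
    exact ⟨(x, ⟨v, hv⟩), by simp⟩
  have hcont : Tendsto (fun S' : X →L[ℂ] X => S'.coprod V.subtypeL) (𝓝 S)
      (𝓝 (S.coprod V.subtypeL)) := by
    have : Continuous fun S' : X →L[ℂ] X => S'.coprod V.subtypeL := by
      have h : (fun S' : X →L[ℂ] X => S'.coprod V.subtypeL) = fun S' =>
          S' ∘L ContinuousLinearMap.fst ℂ X V
            + V.subtypeL ∘L ContinuousLinearMap.snd ℂ X V := by
        ext S' <;> simp
      rw [h]
      fun_prop
    exact this.tendsto S
  filter_upwards [hcont.eventually (eventually_surjective_of_surjective _ hsurj)] with S' hS'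
  refine Module.Finite.of_surjective (S'.range.mkQ ∘ₗ V.subtype) fun y => ?_
  obtain ⟨y, rfl⟩ := S'.range.mkQ_surjective y
  obtain ⟨⟨x, v⟩, rfl⟩ := hS' y
  refine ⟨v, ?_⟩
  have : S'.range.mkQ (S' x) = 0 := by simp
  simp only [ContinuousLinearMap.coprod_apply, map_add, this, zero_add]
  rfl

/-- A sequence annihilated asymptotically by an upper semi-Fredholm operator has a convergent
subsequence. -/
theorem IsUpperSemiFredholm.exists_subseq_tendsto {S : X →L[ℂ] X} (hS : IsUpperSemiFredholm S)
    {f : ℕ → X} {C : ℝ} (hf : ∀ n, ‖f n‖ ≤ C) (hSf : Tendsto (fun n => S (f n)) atTop (𝓝 0)) :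
    ∃ u : X, ∃ φ : ℕ → ℕ, StrictMono φ ∧ Tendsto (f ∘ φ) atTop (𝓝 u) := by
  obtain ⟨hcl, hker⟩ := hS
  have : CompleteSpace S.range := hcl.completeSpace_coe
  have hsurj : Function.Surjective S.rangeRestrict := LinearMap.surjective_rangeRestrict _
  obtain ⟨K, -, hK⟩ := S.rangeRestrict.exists_preimage_norm_le hsurj
  -- By the open mapping theorem on the closed range, `f n` splits into a null sequence `g n` and a
  -- bounded sequence in the finite-dimensional kernel.
  choose g hg hgK using fun n => hK (S.rangeRestrict (f n))
  have hg' : ∀ n, S (g n) = S (f n) := fun n => congrArg Subtype.val (hg n)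
  have hg0 : Tendsto g atTop (𝓝 0) := by
    refine squeeze_zero_norm hgK ?_
    have h := (tendsto_norm_zero.comp hSf).const_mul K
    rwa [mul_zero] at h
  let k : ℕ → S.ker := fun n => ⟨f n - g n, by simp [hg']⟩
  obtain ⟨B, hB⟩ := hg0.norm.bddAbove_range
  have hk : ∀ n, k n ∈ Metric.closedBall (0 : S.ker) (C + B) := fun n => by
    rw [mem_closedBall_zero_iff]
    exact (norm_sub_le _ _).trans (add_le_add (hf n) (hB ⟨n, rfl⟩))
  have : ProperSpace S.ker := FiniteDimensional.proper ℂ _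
  obtain ⟨u, -, φ, hφ, hu⟩ := (isCompact_closedBall (0 : S.ker) (C + B)).tendsto_subseq hk
  refine ⟨u, φ, hφ, ?_⟩
  have h1 := (continuous_subtype_val.tendsto u).comp hu
  have h2 := h1.add (hg0.comp hφ.tendsto_atTop)
  rw [add_zero] at h2
  refine h2.congr fun n => ?_
  simp [k]

end BanachSpaces

/-! ### Uniform limits and zeros of holomorphic functions. -/

/-- Weierstrass' theorem on a normed space: uniform limits of holomorphic functions. -/
theorem differentiableOn_of_tendstoUniformlyOn {E : Type*} [NormedAddCommGroup E]
    [NormedSpace ℂ E] {U : Set E} (hU : IsOpen U) {F : ℕ → E → ℂ} {f : E → ℂ}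
    (hF : ∀ n, DifferentiableOn ℂ (F n) U) (h : TendstoUniformlyOn F f atTop U) :
    DifferentiableOn ℂ f U := by
  intro x hx
  obtain ⟨r, hr, hrU⟩ := Metric.isOpen_iff.1 hU x hx
  have hsub : ∀ y ∈ Metric.ball x (r / 2), Metric.ball y (r / 2) ⊆ U := fun y hy =>
    (Metric.ball_subset_ball' (by rw [Metric.mem_ball] at hy; linarith)).trans hrU
  have hxU : Metric.ball x (r / 2) ⊆ U :=
    (Metric.ball_subset_ball (by linarith)).trans hrU
  have hcauchy : UniformCauchySeqOn (fun n => fderiv ℂ (F n)) atTop (Metric.ball x (r / 2)) := by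
    rw [Metric.uniformCauchySeqOn_iff]
    intro ε hε
    -- With this tolerance, `F m - F n` varies by at most `ε * r / 4` on a ball of radius `r / 2`,
    -- so the Cauchy estimate bounds its derivative by `ε / 2`.
    obtain ⟨N, hN⟩ := Metric.uniformCauchySeqOn_iff.1 h.uniformCauchySeqOn (ε * r / 8)
      (by positivity)
    refine ⟨N, fun m hm n hn y hy => ?_⟩
    have hyU : U ∈ 𝓝 y := hU.mem_nhds (hxU hy)
    rw [dist_eq_norm, ← fderiv_sub ((hF m).differentiableAt hyU) ((hF n).differentiableAt hyU)]
    refine (Complex.norm_fderiv_le_div_of_mapsTo_ball (R₁ := r / 2) (R₂ := ε * r / 4)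
      (((hF m).sub (hF n)).mono (hsub y hy)) (fun z hz => ?_) (by positivity)).trans_lt ?_
    · have h1 := hN m hm n hn z (hsub y hy hz)
      have h2 := hN m hm n hn y (hxU hy)
      rw [dist_eq_norm] at h1 h2
      rw [Metric.mem_closedBall, dist_eq_norm]
      refine (norm_sub_le _ _).trans ?_
      simp only [Pi.sub_apply]
      linarith
    · rw [div_lt_iff₀ (by positivity)]
      nlinarith
  have hlim : ∀ y ∈ Metric.ball x (r / 2), ∃ L, Tendsto (fun n => fderiv ℂ (F n) y) atTop (𝓝 L) :=
    fun y hy => cauchySeq_tendsto_of_complete (hcauchy.cauchySeq hy)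
  choose! f' hf' using hlim
  have hconv := hcauchy.tendstoUniformlyOn_of_tendsto hf'
  exact (hasFDerivAt_of_tendstoUniformlyOn Metric.isOpen_ball hconv
    (fun n y hy => ((hF n).differentiableAt (hU.mem_nhds (hxU hy))).hasFDerivAt)
    (fun y hy => h.tendsto_at (hxU hy))
    (Metric.mem_ball_self (by positivity))).differentiableAt.differentiableWithinAt

/-- Zeros of holomorphic functions of two variables are not isolated. -/
theorem infinite_zeros_of_differentiableOn {U : Set (ℂ × ℂ)} (hU : IsOpen U) {F : ℂ × ℂ → ℂ}
    (hF : DifferentiableOn ℂ F U) {t : ℂ × ℂ} (ht : t ∈ U) (h0 : F t = 0) :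
    {s ∈ U | F s = 0}.Infinite := by
  intro hfin
  obtain ⟨a, b⟩ := t
  obtain ⟨r, hr, hrU⟩ := Metric.isOpen_iff.1 hU _ ht
  -- a circle around `b` on which `F (a, ·)` has no zero
  obtain ⟨ρ, hρ, hρz⟩ : ∃ ρ ∈ Set.Ioo 0 r, ∀ z ∈ Metric.sphere b ρ, F (a, z) ≠ 0 := by
    have hinf : (Set.Ioo 0 r \ (fun s : ℂ × ℂ => dist s.2 b) '' {s ∈ U | F s = 0}).Nonempty :=
      ((Set.Ioo_infinite hr).sdiff (hfin.image _)).nonempty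
    obtain ⟨ρ, hρ, hρ'⟩ := hinf
    refine ⟨ρ, hρ, fun z hz h => hρ' ⟨(a, z), ⟨hrU ?_, h⟩, hz⟩⟩
    rw [Metric.mem_ball, Prod.dist_eq]
    simp only [dist_self]
    rw [Metric.mem_sphere.1 hz]
    exact max_lt hr hρ.2
  have hsub : Metric.ball a r ×ˢ Metric.ball b r ⊆ U := by
    rwa [ball_prod_same]
  have hK : Metric.closedBall b ρ ⊆ Metric.ball b r := Metric.closedBall_subset_ball hρ.2
  have hcont : ContinuousOn F U := hF.continuousOn
  -- lower bound on the circle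
  obtain ⟨δ, hδ, hδz⟩ : ∃ δ > 0, ∀ z ∈ Metric.sphere b ρ, δ < ‖F (a, z)‖ := by
    have hc : ContinuousOn (fun z => ‖F (a, z)‖) (Metric.sphere b ρ) := by
      refine (hcont.comp (by fun_prop) fun z hz => hsub ⟨Metric.mem_ball_self hr, ?_⟩).norm
      exact hK (Metric.sphere_subset_closedBall hz)
    obtain ⟨z₀, hz₀, hmin⟩ := (isCompact_sphere b ρ).exists_isMinOn
      (NormedSpace.sphere_nonempty.2 hρ.1.le) hc
    have : 0 < ‖F (a, z₀)‖ := norm_pos_iff.2 (hρz z₀ hz₀)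
    exact ⟨‖F (a, z₀)‖ / 2, by positivity, fun z hz =>
      (half_lt_self this).trans_le (hmin hz)⟩
  have hnear : ∀ᶠ x in 𝓝 a, ∀ z ∈ Metric.sphere b ρ, δ < ‖F (x, z)‖ := by
    refine (isCompact_sphere b ρ).eventually_forall_of_forall_eventually fun z hz => ?_
    have hmem : (a, z) ∈ U :=
      hsub ⟨Metric.mem_ball_self hr, hK (Metric.sphere_subset_closedBall hz)⟩
    exact (hcont.continuousAt (hU.mem_nhds hmem)).norm.eventually (lt_mem_nhds (hδz z hz))
  have hcentre : ∀ᶠ x in 𝓝 a, ‖F (x, b)‖ < δ / 4 := by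
    have h1 : ContinuousAt (fun x => F (x, b)) a :=
      (hcont.continuousAt (hU.mem_nhds ht)).comp (f := fun x : ℂ => (x, b)) (by fun_prop)
    refine h1.norm.eventually (gt_mem_nhds ?_)
    simp only [h0, norm_zero]
    positivity
  -- Each slice near `a` has a zero: on the circle `F (x, ·)` stays at distance at least `δ / 2`
  -- from `F (x, b)`, so its image contains the ball of radius `δ / 4` about `F (x, b)`, which
  -- contains `0`.
  have hzero : ∀ᶠ x in 𝓝 a, x ∈ Prod.fst '' {s ∈ U | F s = 0} := by
    filter_upwards [hnear, hcentre, Metric.ball_mem_nhds a hr] with x hx hxb hxr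
    have hd : DifferentiableOn ℂ (fun z => F (x, z)) (Metric.ball b r) :=
      hF.comp (by fun_prop) fun z hz => hsub ⟨hxr, hz⟩
    by_cases hfr : ∃ᶠ z in 𝓝 b, F (x, z) ≠ F (x, b)
    · have hball := DiffContOnCl.ball_subset_image_closedBall (f := fun z => F (x, z))
        (z₀ := b) (r := ρ) (ε := δ / 2)
        ((hd.mono (Metric.closedBall_subset_ball hρ.2)).diffContOnCl_ball subset_rfl) hρ.1
        (fun z hz => ?_) hfr
      · obtain ⟨z, hz, hz0⟩ := hball (show (0 : ℂ) ∈ Metric.ball (F (x, b)) (δ / 2 / 2) by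
          rw [Metric.mem_ball, dist_zero_left]; linarith)
        exact ⟨(x, z), ⟨hsub ⟨hxr, hK hz⟩, hz0⟩, rfl⟩
      · have := norm_sub_norm_le (F (x, z)) (F (x, b))
        have := hx z hz
        linarith
    · -- constant case, excluded by the maximum principle
      exfalso
      rw [not_frequently] at hfr
      have han : AnalyticOnNhd ℂ (fun z => F (x, z)) (Metric.ball b r) :=
        hd.analyticOnNhd Metric.isOpen_ball
      have hconst := han.eqOn_of_preconnected_of_eventuallyEq (analyticOnNhd_const (v := F (x, b)))
        (convex_ball b r).isPreconnected (Metric.mem_ball_self hr)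
        (hfr.mono fun z hz => not_not.1 hz)
      obtain ⟨z, hz⟩ := (NormedSpace.sphere_nonempty (x := b)).2 hρ.1.le
      have h1 : F (x, z) = F (x, b) := hconst (hK (Metric.sphere_subset_closedBall hz))
      have h2 := hx z hz
      rw [h1] at h2
      linarith
  exact (infinite_of_mem_nhds a hzero) (hfin.image _)

/-! ### The bidisc algebra: completeness, interpolation, the torus as boundary, peak functions. -/

section Algebra

theorem isOpen_openBidisc : IsOpen openBidisc :=
  (isOpen_lt continuous_fst.norm continuous_const).inter
    (isOpen_lt continuous_snd.norm continuous_const)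

theorem openBidisc_subset_closedBidisc : openBidisc ⊆ closedBidisc :=
  fun _ hz => ⟨hz.1.le, hz.2.le⟩

/-- Extension by zero of a function on the closed bidisc. -/
def zeroExtend (f : closedBidisc → ℂ) : ℂ × ℂ → ℂ := Function.extend Subtype.val f 0

@[simp]
theorem zeroExtend_coe (f : closedBidisc → ℂ) (z : closedBidisc) : zeroExtend f z = f z :=
  Subtype.val_injective.extend_apply _ _ _

theorem mem_bidiscAlgebra_iff {f : C(closedBidisc, ℂ)} :
    f ∈ bidiscAlgebra ↔ DifferentiableOn ℂ (zeroExtend f) openBidisc := by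
  refine ⟨fun ⟨F, hF, hFf⟩ => hF.congr fun z hz => ?_, fun h => ⟨_, h, zeroExtend_coe f⟩⟩
  have h := zeroExtend_coe f ⟨z, openBidisc_subset_closedBidisc hz⟩
  rw [← hFf] at h
  exact h

theorem isClosed_bidiscAlgebra : IsClosed (bidiscAlgebra : Set C(closedBidisc, ℂ)) := by
  refine IsSeqClosed.isClosed fun F f hF hf => ?_
  rw [SetLike.mem_coe, mem_bidiscAlgebra_iff]
  refine differentiableOn_of_tendstoUniformlyOn (F := fun n => zeroExtend (F n)) isOpen_openBidisc
    (fun n => mem_bidiscAlgebra_iff.1 (hF n)) ?_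
  rw [ContinuousMap.tendsto_iff_tendstoUniformly, Metric.tendstoUniformly_iff] at hf
  rw [Metric.tendstoUniformlyOn_iff]
  intro ε hε
  filter_upwards [hf ε hε] with n hn z hz
  lift z to closedBidisc using openBidisc_subset_closedBidisc hz
  simpa using hn z

instance instCompleteSpaceBidiscAlgebra : CompleteSpace bidiscAlgebra :=
  isClosed_bidiscAlgebra.completeSpace_coe

theorem inv_mem_bidiscAlgebra {f : C(closedBidisc, ℂ)} (hf : f ∈ bidiscAlgebra)
    (h0 : ∀ z, f z ≠ 0) : ∃ g ∈ bidiscAlgebra, f * g = 1 := by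
  refine ⟨⟨fun z => (f z)⁻¹, f.continuous.inv₀ h0⟩, ?_, ?_⟩
  · refine ⟨fun z => (zeroExtend f z)⁻¹, (mem_bidiscAlgebra_iff.1 hf).inv fun z hz => ?_,
      fun z => by simp⟩
    lift z to closedBidisc using openBidisc_subset_closedBidisc hz
    simpa using h0 z
  · ext z
    exact mul_inv_cancel₀ (h0 z)

theorem isUnit_of_forall_ne_zero {f : bidiscAlgebra} (h0 : ∀ z, f.1 z ≠ 0) : IsUnit f := by
  obtain ⟨g, hg, hfg⟩ := inv_mem_bidiscAlgebra f.2 h0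
  exact IsUnit.of_mul_eq_one ⟨g, hg⟩ (Subtype.ext hfg)

theorem norm_coe_le (f : bidiscAlgebra) (z : closedBidisc) : ‖f.1 z‖ ≤ ‖f‖ :=
  ContinuousMap.norm_coe_le_norm f.1 z

/-- A linear functional of the coordinates, as an element of the bidisc algebra. -/
def linearFunction (L : ℂ × ℂ →L[ℂ] ℂ) : bidiscAlgebra :=
  ⟨⟨fun z => L z, by fun_prop⟩, L, L.differentiable.differentiableOn, fun _ => rfl⟩

theorem exists_eq_one_eq_zero {s t : closedBidisc} (h : s ≠ t) :
    ∃ g : bidiscAlgebra, g.1 s = 1 ∧ g.1 t = 0 := by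
  obtain ⟨L, hL⟩ : ∃ L : ℂ × ℂ →L[ℂ] ℂ, L s ≠ L t := by
    by_contra! hne
    exact h (Subtype.ext (Prod.ext (hne (.fst ℂ ℂ ℂ)) (hne (.snd ℂ ℂ ℂ))))
  refine ⟨(L s - L t)⁻¹ • (linearFunction L - algebraMap ℂ _ (L t)), ?_, ?_⟩
  · exact inv_mul_cancel₀ (sub_ne_zero.2 hL)
  · change _ * (L t - L t) = 0
    rw [sub_self, mul_zero]

theorem exists_eq_one_eq_zero_of_notMem (s : closedBidisc) (S : Finset closedBidisc)
    (hs : s ∉ S) : ∃ g : bidiscAlgebra, g.1 s = 1 ∧ ∀ t ∈ S, g.1 t = 0 := by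
  classical
  induction S using Finset.induction_on with
  | empty => exact ⟨1, rfl, by simp⟩
  | insert a S ha ih =>
    rw [Finset.mem_insert, not_or] at hs
    obtain ⟨g, hg1, hg⟩ := ih hs.2
    obtain ⟨k, hk1, hk⟩ := exists_eq_one_eq_zero hs.1
    refine ⟨g * k, ?_, fun t ht => ?_⟩
    · change g.1 s * k.1 s = 1
      rw [hg1, hk1, one_mul]
    · change g.1 t * k.1 t = 0
      rcases Finset.mem_insert.1 ht with rfl | ht
      · rw [hk, mul_zero]
      · rw [hg t ht, zero_mul]

/-- A subspace of the bidisc algebra annihilated by infinitely many functionals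
`g ↦ ∑ k < N, c k s * g (ψ k s)` with pairwise disjoint supports has infinite codimension. -/
theorem not_finiteDimensional_quotient (M : Submodule ℂ bidiscAlgebra) {Z : Set closedBidisc}
    (hZ : Z.Infinite) {N : ℕ} (hN : 0 < N) (ψ : ℕ → closedBidisc → closedBidisc)
    (c : ℕ → closedBidisc → ℂ) (hψ0 : ∀ s ∈ Z, ψ 0 s = s) (hc : ∀ s ∈ Z, c 0 s ≠ 0)
    (hψ : ∀ k < N, 0 < k → ∀ s ∈ Z, ψ k s ∉ Z)
    (hM : ∀ s ∈ Z, ∀ g ∈ M, ∑ k ∈ Finset.range N, c k s * g.1 (ψ k s) = 0) :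
    ¬ FiniteDimensional ℂ (bidiscAlgebra ⧸ M) := by
  classical
  intro hfin
  let ev : closedBidisc → bidiscAlgebra →ₗ[ℂ] ℂ := fun s =>
    { toFun := fun g => g.1 s, map_add' := fun _ _ => rfl, map_smul' := fun _ _ => rfl }
  let L : closedBidisc → bidiscAlgebra →ₗ[ℂ] ℂ := fun s =>
    ∑ k ∈ Finset.range N, c k s • ev (ψ k s)
  have hL : ∀ s g, L s g = ∑ k ∈ Finset.range N, c k s * g.1 (ψ k s) := fun s g => by
    simp [L, ev]
  let Λ : Z → Module.Dual ℂ (bidiscAlgebra ⧸ M) := fun s =>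
    M.liftQ (L s) fun g hg => by rw [LinearMap.mem_ker, hL]; exact hM s s.2 g hg
  have hind : LinearIndependent ℂ Λ := by
    rw [linearIndependent_iff']
    intro I a ha i hi
    -- This `g` is `1` at `i` and `0` at every other point entering the finite relation, so it
    -- isolates the coefficient of `i`.
    obtain ⟨g, hg1, hg⟩ := exists_eq_one_eq_zero_of_notMem i.1
      ((Finset.range N ×ˢ I).image (fun p => ψ p.1 p.2) \ {i.1}) (by simp)
    have hval : ∀ j ∈ I, L j g = if j = i then c 0 i else 0 := by
      intro j hj
      have hzero : ∀ k < N, ψ k j ≠ i.1 → g.1 (ψ k j) = 0 := fun k hk hne => hg _ (by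
        rw [Finset.mem_sdiff, Finset.mem_singleton]
        exact ⟨Finset.mem_image.2 ⟨(k, j), by simp [hk, hj], rfl⟩, hne⟩)
      rw [hL, Finset.sum_eq_single_of_mem 0 (Finset.mem_range.2 hN)]
      · rw [hψ0 j j.2]
        split_ifs with hji
        · rw [hji, hg1, mul_one]
        · have := hzero 0 hN (by rw [hψ0 j j.2]; exact fun h => hji (Subtype.ext h))
          rw [hψ0 j j.2] at this
          rw [this, mul_zero]
      · intro k hk hk0
        rw [hzero k (Finset.mem_range.1 hk), mul_zero]
        intro h
        exact hψ k (Finset.mem_range.1 hk) (Nat.pos_of_ne_zero hk0) j j.2 (h ▸ i.2)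
    have h := LinearMap.congr_fun ha (M.mkQ g)
    rw [LinearMap.sum_apply] at h
    have h' : ∑ j ∈ I, a j * L j g = 0 := h
    rw [Finset.sum_congr rfl fun j hj => by rw [hval j hj]] at h'
    simpa [hi, hc i i.2] using h'
  have : Finite Z := hind.finite
  exact hZ (Set.toFinite Z)

theorem infinite_zeros {f : bidiscAlgebra} {V : Set closedBidisc} (hV : IsOpen V)
    {t : closedBidisc} (htV : t ∈ V) (ht : t.1 ∈ openBidisc) (h0 : f.1 t = 0) :
    {s ∈ V | f.1 s = 0}.Infinite := by
  obtain ⟨V', hV', rfl⟩ := isOpen_induced_iff.1 hV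
  have h := infinite_zeros_of_differentiableOn (hV'.inter isOpen_openBidisc)
    ((mem_bidiscAlgebra_iff.1 f.2).mono Set.inter_subset_right) (t := t) ⟨htV, ht⟩ (by simpa)
  refine Set.Infinite.of_image Subtype.val (h.mono ?_)
  rintro s ⟨⟨hs, hso⟩, hs0⟩
  lift s to closedBidisc using openBidisc_subset_closedBidisc hso
  exact ⟨s, ⟨hs, by simpa using hs0⟩, rfl⟩

/-- The torus is a boundary for the bidisc algebra. -/
theorem norm_le_of_forall_torus {f : bidiscAlgebra} {C : ℝ} (hC : ∀ t ∈ torus, ‖f.1 t‖ ≤ C) :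
    ‖f‖ ≤ C := by
  have hC0 : 0 ≤ C :=
    (norm_nonneg _).trans (hC ⟨(1, 1), by simp [closedBidisc]⟩ (by simp [torus]))
  refine (ContinuousMap.norm_le _ hC0).2 fun z => le_of_forall_pos_le_add fun ε hε => ?_
  have huc := CompactSpace.uniformContinuous_of_continuous f.1.continuous
  obtain ⟨δ, hδ, hδf⟩ := Metric.uniformContinuous_iff.1 huc (ε / 2) (by positivity)
  obtain ⟨r, hr0, hr1⟩ : ∃ r : ℝ, max 0 (1 - δ) < r ∧ r < 1 :=
    exists_between (max_lt one_pos (by linarith))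
  have hr : 0 < r := (le_max_left _ _).trans_lt hr0
  have hrδ : 1 - r < δ := by linarith [(le_max_right 0 (1 - δ)).trans_lt hr0]
  have hball : ∀ u : ℂ, ‖u‖ ≤ 1 → ‖(r : ℂ) * u‖ < 1 := fun u hu => by
    rw [norm_mul, Complex.norm_real, Real.norm_of_nonneg hr.le]
    nlinarith [norm_nonneg u]
  have hdist : ∀ u : ℂ, ‖u‖ ≤ 1 → dist ((r : ℂ) * u) u < δ := fun u hu => by
    have h1 : (r : ℂ) * u - u = ((r - 1 : ℝ) : ℂ) * u := by push_cast; ring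
    rw [dist_eq_norm, h1, norm_mul, Complex.norm_real, Real.norm_eq_abs, abs_sub_comm,
      abs_of_pos (by linarith)]
    nlinarith [norm_nonneg u]
  set F := zeroExtend f.1
  have hFd : DifferentiableOn ℂ F openBidisc := mem_bidiscAlgebra_iff.1 f.2
  -- The dilate is holomorphic across the boundary, so the one-variable maximum principle applies in
  -- each coordinate in turn; uniform continuity controls its distance from `f`.
  let G : ℂ → ℂ → ℂ := fun a b => F (r * a, r * b)
  have hclose : ∀ s : closedBidisc, ‖G s.1.1 s.1.2 - f.1 s‖ < ε / 2 := fun s => by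
    have hs : ((r : ℂ) * s.1.1, (r : ℂ) * s.1.2) ∈ closedBidisc :=
      openBidisc_subset_closedBidisc ⟨hball _ s.2.1, hball _ s.2.2⟩
    have h1 := hδf (show dist (⟨_, hs⟩ : closedBidisc) s < δ from
      max_lt (hdist _ s.2.1) (hdist _ s.2.2))
    rw [dist_eq_norm] at h1
    have h2 : G s.1.1 s.1.2 = f.1 ⟨_, hs⟩ := zeroExtend_coe f.1 ⟨_, hs⟩
    rwa [h2]
  have hmax : ∀ g : ℂ → ℂ, (∀ u, ‖u‖ ≤ 1 → DifferentiableAt ℂ g u) → ∀ B : ℝ,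
      (∀ u, ‖u‖ = 1 → ‖g u‖ ≤ B) → ∀ u, ‖u‖ ≤ 1 → ‖g u‖ ≤ B := by
    intro g hg B hB u hu
    have hd : DiffContOnCl ℂ g (Metric.ball 0 1) :=
      DifferentiableOn.diffContOnCl fun v hv => (hg v (by
        simpa using Metric.closure_ball_subset_closedBall hv)).differentiableWithinAt
    refine Complex.norm_le_of_forall_mem_frontier_norm_le Metric.isBounded_ball hd
      (fun v hv => hB v ?_) ?_
    · rw [frontier_ball _ one_ne_zero] at hv
      simpa using hv
    · rw [closure_ball _ one_ne_zero]
      simpa using hu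
  have hdiff : ∀ a b : ℂ, ‖a‖ ≤ 1 → ‖b‖ ≤ 1 → DifferentiableAt ℂ F (r * a, r * b) :=
    fun a b ha hb => hFd.differentiableAt (isOpen_openBidisc.mem_nhds ⟨hball a ha, hball b hb⟩)
  have hGle : ‖G z.1.1 z.1.2‖ ≤ C + ε / 2 := by
    refine hmax (fun a => G a z.1.2) (fun a ha => ?_) _ (fun a ha => ?_) _ z.2.1
    · exact (hdiff a _ ha z.2.2).comp a (f := fun a : ℂ => ((r : ℂ) * a, (r : ℂ) * z.1.2))
        (by fun_prop)
    · refine hmax (fun b => G a b) (fun b hb => ?_) _ (fun b hb => ?_) _ z.2.2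
      · exact (hdiff a b ha.le hb).comp b (f := fun b : ℂ => ((r : ℂ) * a, (r : ℂ) * b))
          (by fun_prop)
      · have h1 := hclose ⟨(a, b), ha.le, hb.le⟩
        have h2 := hC ⟨(a, b), ha.le, hb.le⟩ ⟨ha, hb⟩
        have h3 := norm_sub_norm_le (G a b) (f.1 ⟨(a, b), ha.le, hb.le⟩)
        linarith
  have h1 := hclose z
  rw [norm_sub_rev] at h1
  have h3 := norm_sub_norm_le (f.1 z) (G z.1.1 z.1.2)
  change ‖f.1 z‖ ≤ C + ε
  linarith

/-- For `t = (a, b)` take the average of `1` and `(z₁ / a + z₂ / b) / 2`. By strict convexity of the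
disc, modulus one forces `z₁ / a = z₂ / b = 1`. -/
theorem exists_peak {t : closedBidisc} (ht : t ∈ torus) :
    ∃ g : bidiscAlgebra, g.1 t = 1 ∧ ∀ s, s ≠ t → ‖g.1 s‖ < 1 := by
  obtain ⟨ha, hb⟩ := ht
  set a := t.1.1
  set b := t.1.2
  let L : ℂ × ℂ →L[ℂ] ℂ := (1 / 2 : ℝ) • (a⁻¹ • .fst ℂ ℂ ℂ) + (1 / 2 : ℝ) • (b⁻¹ • .snd ℂ ℂ ℂ)
  have hL : ∀ z, L z = (1 / 2 : ℝ) • (a⁻¹ * z.1) + (1 / 2 : ℝ) • (b⁻¹ * z.2) := fun _ => rfl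
  have ha0 : a ≠ 0 := norm_ne_zero_iff.1 (by rw [ha]; exact one_ne_zero)
  have hb0 : b ≠ 0 := norm_ne_zero_iff.1 (by rw [hb]; exact one_ne_zero)
  let g : bidiscAlgebra := (1 / 2 : ℝ) • 1 + (1 / 2 : ℝ) • linearFunction L
  have hg : ∀ z : closedBidisc, g.1 z = (1 / 2 : ℝ) • (1 : ℂ) + (1 / 2 : ℝ) • L z := fun _ => rfl
  refine ⟨g, ?_, fun s hs => ?_⟩
  · rw [hg, hL, inv_mul_cancel₀ ha0, inv_mul_cancel₀ hb0, ← add_smul, add_halves, one_smul,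
      ← add_smul, add_halves, one_smul]
  · have h1 : ‖a⁻¹ * s.1.1‖ ≤ 1 := by rw [norm_mul, norm_inv, ha]; simpa using s.2.1
    have h2 : ‖b⁻¹ * s.1.2‖ ≤ 1 := by rw [norm_mul, norm_inv, hb]; simpa using s.2.2
    have hle : ‖L s‖ ≤ 1 := by
      rw [hL]
      refine (norm_add_le _ _).trans ?_
      rw [norm_smul, norm_smul, Real.norm_of_nonneg (by norm_num)]
      linarith
    rw [hg]
    refine norm_combo_lt_of_ne norm_one.le hle (fun h => hs ?_) (by norm_num) (by norm_num)
      (by norm_num)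
    have heq : a⁻¹ * s.1.1 = b⁻¹ * s.1.2 := by
      by_contra hne
      have := norm_combo_lt_of_ne h1 h2 hne (a := 1 / 2) (b := 1 / 2) (by norm_num) (by norm_num)
        (by norm_num)
      rw [← hL, ← h, norm_one] at this
      exact lt_irrefl _ this
    rw [hL, ← heq, ← add_smul] at h
    norm_num at h
    have h' := heq.symm.trans h.symm
    refine Subtype.ext (Prod.ext ?_ ?_)
    · exact ((inv_mul_eq_one₀ ha0).1 h.symm).symm
    · exact ((inv_mul_eq_one₀ hb0).1 h').symm

/-- Dini's theorem: `|h| |g| ^ n` decreases pointwise to `0` on a compact space, the peak point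
being covered by the zero of `h`. -/
theorem tendsto_mul_pow_of_peak {h g : bidiscAlgebra} {t : closedBidisc} (ht : h.1 t = 0)
    (hgt : g.1 t = 1) (hg : ∀ s, s ≠ t → ‖g.1 s‖ < 1) :
    Tendsto (fun n => h * g ^ n) atTop (𝓝 0) := by
  have hg1 : ∀ s, ‖g.1 s‖ ≤ 1 := fun s => by
    by_cases hs : s = t
    · rw [hs, hgt, norm_one]
    · exact (hg s hs).le
  have hunif : TendstoUniformly (fun n s => ‖h.1 s‖ * ‖g.1 s‖ ^ n) (fun _ => (0 : ℝ)) atTop := by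
    refine Antitone.tendstoUniformly_of_forall_tendsto (fun n => by fun_prop) (fun n k hnk s => ?_)
      continuous_const fun s => ?_
    · exact mul_le_mul_of_nonneg_left (pow_le_pow_of_le_one (norm_nonneg _) (hg1 s) hnk)
        (norm_nonneg _)
    · by_cases hs : s = t
      · simp [hs, ht]
      · simpa using (tendsto_pow_atTop_nhds_zero_of_lt_one (norm_nonneg _) (hg s hs)).const_mul
          ‖h.1 s‖
  rw [tendsto_zero_iff_norm_tendsto_zero, Metric.tendsto_atTop]
  rw [Metric.tendstoUniformly_iff] at hunif
  intro ε hε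
  obtain ⟨n₀, hn₀⟩ := eventually_atTop.1 (hunif (ε / 2) (by positivity))
  refine ⟨n₀, fun n hn => ?_⟩
  rw [dist_zero_right, norm_norm]
  refine lt_of_le_of_lt ((ContinuousMap.norm_le _ (by positivity : 0 ≤ ε / 2)).2 fun s => ?_)
    (half_lt_self hε)
  have h1 := hn₀ n hn s
  rw [dist_zero_left, Real.norm_of_nonneg (by positivity), ← norm_pow, ← norm_mul] at h1
  exact h1.le

end Algebra

/-! ### The factorization of `μ ^ m - T ^ m`. -/

section Cofactor

variable {X : Type*} [NormedAddCommGroup X] [NormedSpace ℂ X]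

/-- The operator `∑ i < m, μ ^ (m - 1 - i) T ^ i`, whose product with `μ - T` is `μ ^ m - T ^ m`. -/
def cofactor (T : X →L[ℂ] X) (μ : ℂ) (m : ℕ) : X →L[ℂ] X :=
  ∑ i ∈ Finset.range m, μ ^ (m - 1 - i) • T ^ i

theorem cofactor_eq (T : X →L[ℂ] X) (μ : ℂ) (m : ℕ) :
    cofactor T μ m =
      ∑ i ∈ Finset.range m, T ^ i * algebraMap ℂ (X →L[ℂ] X) μ ^ (m - 1 - i) := by
  refine Finset.sum_congr rfl fun i _ => ?_
  rw [← map_pow, ← Algebra.commutes, ← Algebra.smul_def]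

theorem sub_mul_cofactor (T : X →L[ℂ] X) (μ : ℂ) (m : ℕ) :
    (μ • ContinuousLinearMap.id ℂ X - T) * cofactor T μ m = algebraMap ℂ _ (μ ^ m) - T ^ m := by
  have h := (Algebra.commute_algebraMap_right μ T).mul_geom_sum₂ m
  rw [← cofactor_eq] at h
  rw [map_pow]
  rw [← neg_sub (T ^ m), ← h, ← neg_mul, neg_sub]
  rfl

theorem cofactor_mul_sub (T : X →L[ℂ] X) (μ : ℂ) (m : ℕ) :
    cofactor T μ m * (μ • ContinuousLinearMap.id ℂ X - T) = algebraMap ℂ _ (μ ^ m) - T ^ m := by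
  have h := (Algebra.commute_algebraMap_right μ T).geom_sum₂_mul m
  rw [← cofactor_eq] at h
  rw [map_pow]
  rw [← neg_sub (T ^ m), ← h, ← mul_neg, neg_sub]
  rfl

end Cofactor

/-! ### Orbits of the rotation. -/

section Rotation

variable {α₁ α₂ : Circle}

theorem rotation_iterate_coe (k : ℕ) (z : closedBidisc) :
    ((rotation α₁ α₂)^[k] z : ℂ × ℂ) = ((α₁ : ℂ) ^ k * z.1.1, (α₂ : ℂ) ^ k * z.1.2) := by
  induction k with
  | zero => simp
  | succ k ih =>
    rw [Function.iterate_succ_apply']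
    change ((α₁ : ℂ) * ((rotation α₁ α₂)^[k] z : ℂ × ℂ).1,
      (α₂ : ℂ) * ((rotation α₁ α₂)^[k] z : ℂ × ℂ).2) = _
    rw [ih, pow_succ', pow_succ', mul_assoc, mul_assoc]

theorem rotation_injective : Function.Injective (rotation α₁ α₂) := by
  intro z z' h
  have h1 := congrArg (fun x : closedBidisc => x.1.1) h
  have h2 := congrArg (fun x : closedBidisc => x.1.2) h
  exact Subtype.ext (Prod.ext (mul_left_cancel₀ α₁.coe_ne_zero h1)
    (mul_left_cancel₀ α₂.coe_ne_zero h2))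

theorem continuous_rotation_iterate (k : ℕ) : Continuous (rotation α₁ α₂)^[k] :=
  (rotation α₁ α₂).continuous.iterate k

theorem rotation_iterate_mem_torus {t : closedBidisc} (ht : t ∈ torus) (k : ℕ) :
    (rotation α₁ α₂)^[k] t ∈ torus := by
  simpa [torus, rotation_iterate_coe, Circle.norm_coe] using ht

theorem rotation_iterate_lcm {p q : ℕ} (hα₁ : IsPrimitiveRoot (α₁ : ℂ) p)
    (hα₂ : IsPrimitiveRoot (α₂ : ℂ) q) (z : closedBidisc) :
    (rotation α₁ α₂)^[p.lcm q] z = z := by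
  refine Subtype.ext ?_
  rw [rotation_iterate_coe, (hα₁.pow_eq_one_iff_dvd _).2 (Nat.dvd_lcm_left p q),
    (hα₂.pow_eq_one_iff_dvd _).2 (Nat.dvd_lcm_right p q), one_mul, one_mul]

/-- Off the axes, a return after `k` steps makes both `p` and `q` divide `k`. -/
theorem rotation_iterate_ne {p q : ℕ} (hα₁ : IsPrimitiveRoot (α₁ : ℂ) p)
    (hα₂ : IsPrimitiveRoot (α₂ : ℂ) q) {z : closedBidisc} (h1 : z.1.1 ≠ 0) (h2 : z.1.2 ≠ 0)
    {k : ℕ} (hk0 : 0 < k) (hk : k < p.lcm q) : (rotation α₁ α₂)^[k] z ≠ z := by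
  intro h
  have h' := congrArg Subtype.val h
  rw [rotation_iterate_coe, Prod.ext_iff] at h'
  have h1' := (hα₁.pow_eq_one_iff_dvd k).1 (mul_eq_right₀ h1 |>.1 h'.1)
  have h2' := (hα₂.pow_eq_one_iff_dvd k).1 (mul_eq_right₀ h2 |>.1 h'.2)
  exact absurd (Nat.le_of_dvd hk0 (Nat.lcm_dvd h1' h2')) (not_le.2 hk)

theorem fst_ne_zero_of_mem_torus {t : closedBidisc} (ht : t ∈ torus) : t.1.1 ≠ 0 :=
  norm_ne_zero_iff.1 (by rw [ht.1]; exact one_ne_zero)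

theorem snd_ne_zero_of_mem_torus {t : closedBidisc} (ht : t ∈ torus) : t.1.2 ≠ 0 :=
  norm_ne_zero_iff.1 (by rw [ht.2]; exact one_ne_zero)

end Rotation

/-! ### Reduction to multiplication by `μ ^ m - w_m`, and the resulting upper bounds on the spectra.
-/

section WeightedRotation

variable (α₁ α₂ : Circle) (w : bidiscAlgebra)

theorem weightedRotation_apply (f : bidiscAlgebra) (z : closedBidisc) :
    (weightedRotation α₁ α₂ w f).1 z = w.1 z * f.1 (rotation α₁ α₂ z) := rfl

theorem weightedRotation_pow_apply (k : ℕ) (f : bidiscAlgebra) (z : closedBidisc) :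
    ((weightedRotation α₁ α₂ w ^ k) f).1 z =
      weightProduct (rotation α₁ α₂) w.1 k z * f.1 ((rotation α₁ α₂)^[k] z) := by
  induction k generalizing f with
  | zero => simp [weightProduct]
  | succ k ih =>
    rw [pow_succ, mul_apply_eq_comp, ih, weightedRotation_apply,
      Function.iterate_succ_apply', weightProduct, weightProduct, Finset.prod_range_succ,
      mul_assoc]

theorem continuous_weightProduct (k : ℕ) :
    Continuous (weightProduct (rotation α₁ α₂) w.1 k) :=
  continuous_finsetProd _ fun i _ => w.1.continuous.comp (continuous_rotation_iterate i)

theorem cofactor_apply (μ : ℂ) (m : ℕ) (f : bidiscAlgebra) (z : closedBidisc) :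
    (cofactor (weightedRotation α₁ α₂ w) μ m f).1 z =
      ∑ i ∈ Finset.range m, μ ^ (m - 1 - i) * weightProduct (rotation α₁ α₂) w.1 i z *
        f.1 ((rotation α₁ α₂)^[i] z) := by
  let ev : bidiscAlgebra →ₗ[ℂ] ℂ :=
    { toFun := fun g => g.1 z, map_add' := fun _ _ => rfl, map_smul' := fun _ _ => rfl }
  change ev (cofactor (weightedRotation α₁ α₂ w) μ m f) = _
  rw [cofactor, sum_apply, map_sum]
  refine Finset.sum_congr rfl fun i _ => ?_
  rw [smul_apply, map_smul, smul_eq_mul, mul_assoc]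
  exact congrArg _ (weightedRotation_pow_apply α₁ α₂ w i f z)

/-- The function `μ ^ m - w_m`. -/
def characteristicFunction (μ : ℂ) (m : ℕ) : bidiscAlgebra :=
  algebraMap ℂ _ (μ ^ m) - (weightedRotation α₁ α₂ w ^ m) 1

theorem characteristicFunction_apply (μ : ℂ) (m : ℕ) (z : closedBidisc) :
    (characteristicFunction α₁ α₂ w μ m).1 z =
      μ ^ m - weightProduct (rotation α₁ α₂) w.1 m z := by
  change μ ^ m - ((weightedRotation α₁ α₂ w ^ m) 1).1 z = _
  rw [weightedRotation_pow_apply]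
  exact congrArg _ (mul_one _)

variable {α₁ α₂} {m : ℕ} (hΦ : ∀ z, (rotation α₁ α₂)^[m] z = z) (μ : ℂ)
include hΦ

theorem algebraMap_sub_pow_apply (f : bidiscAlgebra) :
    (algebraMap ℂ _ (μ ^ m) - weightedRotation α₁ α₂ w ^ m : bidiscAlgebra →L[ℂ] bidiscAlgebra) f =
      characteristicFunction α₁ α₂ w μ m * f := by
  refine Subtype.ext (ContinuousMap.ext fun z => ?_)
  change μ ^ m * f.1 z - ((weightedRotation α₁ α₂ w ^ m) f).1 z =
    (characteristicFunction α₁ α₂ w μ m).1 z * f.1 z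
  rw [characteristicFunction_apply, weightedRotation_pow_apply, hΦ, sub_mul]

theorem sub_apply_cofactor (f : bidiscAlgebra) :
    (μ • ContinuousLinearMap.id ℂ bidiscAlgebra - weightedRotation α₁ α₂ w)
      (cofactor (weightedRotation α₁ α₂ w) μ m f) = characteristicFunction α₁ α₂ w μ m * f := by
  rw [← algebraMap_sub_pow_apply w hΦ, ← sub_mul_cofactor]
  rfl

theorem cofactor_apply_sub (f : bidiscAlgebra) :
    cofactor (weightedRotation α₁ α₂ w) μ m
      ((μ • ContinuousLinearMap.id ℂ bidiscAlgebra - weightedRotation α₁ α₂ w) f) =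
        characteristicFunction α₁ α₂ w μ m * f := by
  rw [← algebraMap_sub_pow_apply w hΦ, ← cofactor_mul_sub]
  rfl

theorem isUnit_sub_weightedRotation
    (h : ∀ t, μ ^ m ≠ weightProduct (rotation α₁ α₂) w.1 m t) :
    IsUnit (μ • ContinuousLinearMap.id ℂ bidiscAlgebra - weightedRotation α₁ α₂ w) := by
  obtain ⟨g, hg⟩ := (isUnit_of_forall_ne_zero (f := characteristicFunction α₁ α₂ w μ m)
    fun z => by rw [characteristicFunction_apply]; exact sub_ne_zero.2 (h z)).exists_right_inv
  -- Dividing by `χ` after or before the cofactor gives a left or right inverse; no commutation of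
  -- the two operations is needed.
  refine isUnit_iff_exists_and_exists.2
    ⟨⟨cofactor (weightedRotation α₁ α₂ w) μ m * ContinuousLinearMap.mul ℂ _ g, ?_⟩,
      ⟨ContinuousLinearMap.mul ℂ _ g * cofactor (weightedRotation α₁ α₂ w) μ m, ?_⟩⟩
  · refine ContinuousLinearMap.ext fun f => ?_
    refine (sub_apply_cofactor w hΦ μ (g * f)).trans ?_
    rw [← mul_assoc, hg, one_mul]
    rfl
  · refine ContinuousLinearMap.ext fun f => ?_
    refine (congrArg (g * ·) (cofactor_apply_sub w hΦ μ f)).trans ?_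
    rw [← mul_assoc, mul_comm g, hg, one_mul]
    rfl

theorem exists_antilipschitz_sub_weightedRotation
    (h : ∀ t ∈ torus, μ ^ m ≠ weightProduct (rotation α₁ α₂) w.1 m t) :
    ∃ K, AntilipschitzWith K (μ • ContinuousLinearMap.id ℂ bidiscAlgebra - weightedRotation α₁ α₂ w) := by
  set χ := characteristicFunction α₁ α₂ w μ m
  set S := μ • ContinuousLinearMap.id ℂ bidiscAlgebra - weightedRotation α₁ α₂ w
  set R := cofactor (weightedRotation α₁ α₂ w) μ m
  have hcomp : IsCompact torus :=
    ((isClosed_eq (by fun_prop) continuous_const).inter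
      (isClosed_eq (by fun_prop) continuous_const) :
        IsClosed ({t : closedBidisc | ‖t.1.1‖ = 1} ∩ {t | ‖t.1.2‖ = 1})).isCompact
  obtain ⟨t₀, ht₀, hmin⟩ := hcomp.exists_isMinOn ⟨⟨(1, 1), by simp [closedBidisc]⟩,
    by simp [torus]⟩ χ.1.continuous.norm.continuousOn
  have hpos : ∀ t ∈ torus, 0 < ‖χ.1 t‖ := fun t ht => norm_pos_iff.2 (by
    rw [characteristicFunction_apply]; exact sub_ne_zero.2 (h t ht))
  have hc := hpos t₀ ht₀
  refine ⟨‖R‖₊ / ‖χ.1 t₀‖₊, AddMonoidHomClass.antilipschitz_of_bound S fun f => ?_⟩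
  have h1 : ‖χ * f‖ ≤ ‖R‖ * ‖S f‖ := by
    rw [← cofactor_apply_sub w hΦ]
    exact R.le_opNorm _
  refine norm_le_of_forall_torus fun t ht => ?_
  push_cast
  rw [div_mul_eq_mul_div, le_div_iff₀ hc, mul_comm]
  refine le_trans ?_ ((norm_coe_le (χ * f) t).trans h1)
  change _ ≤ ‖χ.1 t * f.1 t‖
  rw [norm_mul]
  exact mul_le_mul_of_nonneg_right (hmin ht) (norm_nonneg _)

end WeightedRotation

/-! ### Connectedness and dense subsets of the closed bidisc. -/

section Topology

instance instConnectedSpaceClosedBidisc : ConnectedSpace closedBidisc := by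
  have h : closedBidisc = Metric.closedBall (0 : ℂ) 1 ×ˢ Metric.closedBall (0 : ℂ) 1 := by
    ext z
    simp [closedBidisc]
  refine isConnected_iff_connectedSpace.1 (Convex.isConnected (h ▸ ?_) ⟨0, by simp [closedBidisc]⟩)
  exact (convex_closedBall _ _).prod (convex_closedBall _ _)

instance instNontrivialClosedBidisc : Nontrivial closedBidisc :=
  ⟨⟨⟨(0, 0), by simp [closedBidisc]⟩, ⟨(1, 1), by simp [closedBidisc]⟩,
    fun h => zero_ne_one (congrArg (fun z : closedBidisc => z.1.1) h)⟩⟩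

/-- The points of the open bidisc off the coordinate axes. -/
def puncturedBidisc : Set closedBidisc := {z | z.1 ∈ openBidisc ∧ z.1.1 ≠ 0 ∧ z.1.2 ≠ 0}

theorem isOpen_puncturedBidisc : IsOpen puncturedBidisc :=
  (isOpen_openBidisc.preimage continuous_subtype_val).inter
    ((isOpen_ne_fun (by fun_prop) continuous_const).inter
      (isOpen_ne_fun (by fun_prop) continuous_const) :
        IsOpen ({z : closedBidisc | z.1.1 ≠ 0} ∩ {z | z.1.2 ≠ 0}))

theorem dense_puncturedBidisc : Dense puncturedBidisc := by
  intro z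
  have h1 : Metric.closedBall (0 : ℂ) 1 ⊆ closure (Metric.ball 0 1 ∩ {0}ᶜ) := by
    rw [← closure_ball (0 : ℂ) one_ne_zero]
    exact closure_minimal ((dense_compl_singleton 0).open_subset_closure_inter Metric.isOpen_ball)
      isClosed_closure
  rw [closure_subtype]
  have h2 : z.1 ∈ closure ((Metric.ball (0 : ℂ) 1 ∩ {0}ᶜ) ×ˢ (Metric.ball (0 : ℂ) 1 ∩ {0}ᶜ)) := by
    rw [closure_prod_eq]
    exact ⟨h1 (by simpa using z.2.1), h1 (by simpa using z.2.2)⟩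
  refine closure_mono ?_ h2
  rintro ⟨a, b⟩ ⟨⟨ha, ha0⟩, hb, hb0⟩
  rw [mem_ball_zero_iff] at ha hb
  exact ⟨⟨(a, b), ha.le, hb.le⟩, ⟨⟨ha, hb⟩, ha0, hb0⟩, rfl⟩

theorem eq_zero_of_forall_notMem_finite {f : bidiscAlgebra} {E : Set closedBidisc} (hE : E.Finite)
    (h : ∀ z ∉ E, f.1 z = 0) : f = 0 := by
  have hd : Dense Eᶜ := by simpa [Set.compl_eq_univ_sdiff] using dense_univ.sdiff_finite hE
  exact Subtype.ext (ContinuousMap.ext (congrFun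
    (Continuous.ext_on hd f.1.continuous continuous_const fun z hz => h z hz)))

end Topology

/-! ### Sequences obstructing the upper semi-Fredholm property. -/

section SingularSequence

/-- A bounded sequence which does not tend to zero in norm, but does so pointwise off a finite
set, and which `S` maps to a null sequence. -/
structure IsSingularSequence (S : bidiscAlgebra →L[ℂ] bidiscAlgebra) (f : ℕ → bidiscAlgebra) :
    Prop where
  bounded : ∃ C, ∀ n, ‖f n‖ ≤ C
  away : ∃ c > 0, ∀ᶠ n in atTop, c ≤ ‖f n‖
  pointwise : ∃ E : Set closedBidisc, E.Finite ∧ ∀ z ∉ E, Tendsto (fun n => (f n).1 z) atTop (𝓝 0)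
  null : Tendsto (fun n => S (f n)) atTop (𝓝 0)

/-- A convergent subsequence would have a limit vanishing off a finite set, hence zero by
continuity, although its norms stay away from zero. -/
theorem IsSingularSequence.not_isUpperSemiFredholm {S : bidiscAlgebra →L[ℂ] bidiscAlgebra}
    {f : ℕ → bidiscAlgebra} (hf : IsSingularSequence S f) : ¬ IsUpperSemiFredholm S := by
  intro hS
  obtain ⟨C, hC⟩ := hf.bounded
  obtain ⟨c, hc, hcf⟩ := hf.away
  obtain ⟨E, hE, hEf⟩ := hf.pointwise
  obtain ⟨u, φ, hφ, hu⟩ := hS.exists_subseq_tendsto hC hf.null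
  have hu0 : u = 0 := by
    refine eq_zero_of_forall_notMem_finite hE fun z hz => ?_
    have hev : Continuous fun g : bidiscAlgebra => g.1 z :=
      (continuous_eval_const z).comp continuous_subtype_val
    exact tendsto_nhds_unique ((hev.tendsto u).comp hu) ((hEf z hz).comp hφ.tendsto_atTop)
  have h1 : c ≤ ‖u‖ := ge_of_tendsto hu.norm (hφ.tendsto_atTop.eventually hcf)
  rw [hu0, norm_zero] at h1
  exact absurd h1 (not_le.2 hc)

theorem IsSingularSequence.mem_approxPointSpectrum {T : bidiscAlgebra →L[ℂ] bidiscAlgebra} {μ : ℂ}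
    {f : ℕ → bidiscAlgebra}
    (hf : IsSingularSequence (μ • ContinuousLinearMap.id ℂ bidiscAlgebra - T) f) :
    μ ∈ approxPointSpectrum T := by
  obtain ⟨c, hc, hcf⟩ := hf.away
  obtain ⟨n₀, hn₀⟩ := eventually_atTop.1 hcf
  have hpos : ∀ n, c ≤ ‖f (n + n₀)‖ := fun n => hn₀ _ (Nat.le_add_left _ _)
  refine ⟨fun n => ((‖f (n + n₀)‖⁻¹ : ℝ) : ℂ) • f (n + n₀), fun n => ?_, ?_⟩
  · rw [norm_smul, Complex.norm_real, norm_inv, norm_norm,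
      inv_mul_cancel₀ (hc.trans_le (hpos n)).ne']
  · have h := ((tendsto_add_atTop_iff_nat n₀).2 hf.null).norm.const_mul c⁻¹
    rw [norm_zero, mul_zero] at h
    refine squeeze_zero_norm (fun n => ?_) h
    rw [map_smul, smul_comm μ, ← smul_sub, norm_smul, Complex.norm_real, norm_inv, norm_norm,
      norm_sub_rev]
    exact mul_le_mul_of_nonneg_right (inv_anti₀ hc (hpos n)) (norm_nonneg _)

end SingularSequence

theorem continuous_smul_id_sub {X : Type*} [NormedAddCommGroup X] [NormedSpace ℂ X]
    (T : X →L[ℂ] X) : Continuous fun ν : ℂ => ν • ContinuousLinearMap.id ℂ X - T := by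
  fun_prop

/-! ### Zeros of `μ ^ m - w_m` as spectral points. -/

section WeightedRotation

variable {α₁ α₂ : Circle} (w : bidiscAlgebra) {m : ℕ}

theorem norm_pow_le_one {g : bidiscAlgebra} (hg : ∀ z, ‖g.1 z‖ ≤ 1) (n : ℕ) : ‖g ^ n‖ ≤ 1 := by
  refine (ContinuousMap.norm_le _ zero_le_one).2 fun z => ?_
  change ‖g.1 z ^ n‖ ≤ 1
  rw [norm_pow]
  exact pow_le_one₀ (norm_nonneg _) (hg z)

theorem exists_eq_zero_of_weightProduct_eq_zero {k : ℕ} {t : closedBidisc}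
    (h : weightProduct (rotation α₁ α₂) w.1 k t = 0) :
    ∃ i < k, w.1 ((rotation α₁ α₂)^[i] t) = 0 := by
  obtain ⟨i, hi, hi0⟩ := Finset.prod_eq_zero_iff.1 h
  exact ⟨i, Finset.mem_range.1 hi, hi0⟩

theorem exists_isSingularSequence (hm : 0 < m) (hΦ : ∀ z, (rotation α₁ α₂)^[m] z = z)
    (hfree : ∀ z : closedBidisc, z.1.1 ≠ 0 → z.1.2 ≠ 0 → ∀ k, 0 < k → k < m →
      (rotation α₁ α₂)^[k] z ≠ z)
    {μ : ℂ} {t : closedBidisc} (ht : t ∈ torus)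
    (hμ : μ ^ m = weightProduct (rotation α₁ α₂) w.1 m t) :
    ∃ f, IsSingularSequence
      (μ • ContinuousLinearMap.id ℂ bidiscAlgebra - weightedRotation α₁ α₂ w) f := by
  have hle : ∀ {g : bidiscAlgebra} {t}, g.1 t = 1 → (∀ s, s ≠ t → ‖g.1 s‖ < 1) →
      ∀ s, ‖g.1 s‖ ≤ 1 := fun {g t} h1 h s => by
    by_cases hs : s = t
    · rw [hs, h1, norm_one]
    · exact (h s hs).le
  have hpow : ∀ {g : bidiscAlgebra} {s}, ‖g.1 s‖ < 1 →
      Tendsto (fun n => (g ^ n).1 s) atTop (𝓝 0) :=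
    fun hs => tendsto_pow_atTop_nhds_zero_of_norm_lt_one hs
  rcases eq_or_ne μ 0 with rfl | hμ0
  -- For `μ = 0` the cofactor reduces to `T ^ (m - 1)` and the lower bound is lost. Since `w`
  -- vanishes at some `s` in the orbit, powers of a function peaking at `Φ s` are used instead.
  · rw [zero_pow hm.ne'] at hμ
    obtain ⟨i, -, hi⟩ := exists_eq_zero_of_weightProduct_eq_zero w hμ.symm
    set s := (rotation α₁ α₂)^[i] t with hs
    have hst : rotation α₁ α₂ s ∈ torus :=
      rotation_iterate_mem_torus (rotation_iterate_mem_torus ht i) 1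
    obtain ⟨g, hg1, hg⟩ := exists_peak hst
    refine ⟨fun n => g ^ n, ⟨1, norm_pow_le_one (hle hg1 hg)⟩, ⟨1, one_pos, .of_forall fun n => ?_⟩,
      ⟨{rotation α₁ α₂ s}, Set.finite_singleton _, fun z hz => hpow (hg z hz)⟩, ?_⟩
    · refine le_trans (le_of_eq ?_) (norm_coe_le (g ^ n) (rotation α₁ α₂ s))
      change 1 = ‖g.1 (rotation α₁ α₂ s) ^ n‖
      rw [hg1, one_pow, norm_one]
    · have h := tendsto_mul_pow_of_peak (h := -w) (g := compRotation α₁ α₂ g) (t := s)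
        (by change -w.1 s = 0; rw [hi, neg_zero]) hg1
        (fun z hz => hg _ (rotation_injective.ne hz))
      refine h.congr fun n => Subtype.ext (ContinuousMap.ext fun z => ?_)
      change -w.1 z * _ ^ n = 0 * _ - w.1 z * _ ^ n
      rw [zero_mul, zero_sub, neg_mul]
      rfl
  · obtain ⟨g, hg1, hg⟩ := exists_peak ht
    set R := cofactor (weightedRotation α₁ α₂ w) μ m
    have hval : ∀ z n, (R (g ^ n)).1 z = ∑ i ∈ Finset.range m, μ ^ (m - 1 - i) *
        weightProduct (rotation α₁ α₂) w.1 i z * (g ^ n).1 ((rotation α₁ α₂)^[i] z) :=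
      fun z n => cofactor_apply α₁ α₂ w μ m (g ^ n) z
    have hpos : 0 < ‖μ ^ (m - 1)‖ := norm_pos_iff.2 (pow_ne_zero _ hμ0)
    -- The exceptional set is the orbit of `t`. A point `z` with `Φ ^ i z = t` equals `Φ ^ (m - i)
    -- t`, and `i = 0` uses the exponent `m`.
    refine ⟨fun n => R (g ^ n), ⟨‖R‖, fun n => ?_⟩, ⟨‖μ ^ (m - 1)‖ / 2, half_pos hpos, ?_⟩,
      ⟨(fun j => (rotation α₁ α₂)^[j] t) '' Set.Iic m, (Set.finite_Iic m).image _,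
        fun z hz => ?_⟩, ?_⟩
    · exact (R.le_opNorm _).trans
        (mul_le_of_le_one_right (norm_nonneg _) (norm_pow_le_one (hle hg1 hg) n))
    · have hlim : Tendsto (fun n => (R (g ^ n)).1 t) atTop (𝓝 (μ ^ (m - 1))) := by
        have : μ ^ (m - 1) = ∑ i ∈ Finset.range m, if i = 0 then μ ^ (m - 1) else 0 := by
          simp [hm.ne']
        rw [this]
        simp only [hval]
        refine tendsto_finsetSum _ fun i hi => ?_
        split_ifs with hi0
        · subst hi0
          refine tendsto_const_nhds.congr fun n => ?_
          change _ = _ * g.1 t ^ n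
          simp [weightProduct, hg1]
        · simpa using (hpow (hg _ (hfree t (fst_ne_zero_of_mem_torus ht)
            (snd_ne_zero_of_mem_torus ht) i (Nat.pos_of_ne_zero hi0)
            (Finset.mem_range.1 hi)))).const_mul _
      filter_upwards [hlim.norm.eventually
        (lt_mem_nhds (half_lt_self hpos))] with n hn
      exact hn.le.trans (norm_coe_le _ t)
    · simp only [hval]
      rw [← Finset.sum_const_zero (s := Finset.range m)]
      refine tendsto_finsetSum _ fun i hi => ?_
      have hne : (rotation α₁ α₂)^[i] z ≠ t := by
        rintro rfl
        refine hz ⟨m - i, Nat.sub_le _ _, ?_⟩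
        have him := (Finset.mem_range.1 hi).le
        simp only
        rw [← Function.iterate_add_apply, Nat.sub_add_cancel him, hΦ]
      simpa using (hpow (hg _ hne)).const_mul _
    · have h := tendsto_mul_pow_of_peak (h := characteristicFunction α₁ α₂ w μ m) (g := g) (t := t)
        (by rw [characteristicFunction_apply, hμ, sub_self]) hg1 hg
      exact h.congr fun n => (sub_apply_cofactor w hΦ μ (g ^ n)).symm

/-- The hypothesis makes `w_m` vanish on a nonempty open set, which is infinite. Finitely many zeros
of `w` would have only finitely many preimages under the injective iterates. -/
theorem infinite_zeros_of_eventually {t₀ : closedBidisc}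
    (h : ∀ᶠ t in 𝓝 t₀, t ∈ puncturedBidisc → weightProduct (rotation α₁ α₂) w.1 m t = 0) :
    {s | w.1 s = 0}.Infinite := by
  intro hfin
  obtain ⟨t, htO, ht⟩ := ((mem_closure_iff_frequently.1 (dense_puncturedBidisc t₀)).and_eventually
    h.eventually_nhds).exists
  have hnhds : ∀ᶠ s in 𝓝 t, weightProduct (rotation α₁ α₂) w.1 m s = 0 := by
    filter_upwards [ht, isOpen_puncturedBidisc.mem_nhds htO] with s hs hsO using hs hsO
  refine infinite_of_mem_nhds t hnhds (((Finset.range m).finite_toSet.biUnion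
    fun i _ => hfin.preimage ((rotation_injective (α₁ := α₁) (α₂ := α₂)).iterate i).injOn).subset fun s hs => ?_)
  obtain ⟨i, hi, hi0⟩ := exists_eq_zero_of_weightProduct_eq_zero w hs
  exact Set.mem_biUnion (Finset.mem_coe.2 (Finset.mem_range.2 hi)) hi0

theorem not_isLowerSemiFredholm_of_infinite_zeros (h : {s | w.1 s = 0}.Infinite) :
    ¬ IsLowerSemiFredholm
      ((0 : ℂ) • ContinuousLinearMap.id ℂ bidiscAlgebra - weightedRotation α₁ α₂ w) := by
  refine not_finiteDimensional_quotient _ h one_pos (fun _ s => s) (fun _ _ => 1)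
    (fun _ _ => rfl) (fun _ _ => one_ne_zero) (fun k hk hk0 => by omega) ?_
  rintro s hs _ ⟨f, rfl⟩
  rw [Finset.sum_range_one, one_mul]
  change 0 * f.1 s - w.1 s * _ = 0
  rw [show w.1 s = 0 from hs, zero_mul, zero_mul, sub_zero]

theorem not_isLowerSemiFredholm_of_mem_puncturedBidisc (hm : 0 < m)
    (hΦ : ∀ z, (rotation α₁ α₂)^[m] z = z)
    (hfree : ∀ z : closedBidisc, z.1.1 ≠ 0 → z.1.2 ≠ 0 → ∀ k, 0 < k → k < m →
      (rotation α₁ α₂)^[k] z ≠ z)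
    {μ : ℂ} (hμ0 : μ ≠ 0) {t : closedBidisc} (ht : t ∈ puncturedBidisc)
    (hμ : μ ^ m = weightProduct (rotation α₁ α₂) w.1 m t) :
    ¬ IsLowerSemiFredholm
      (μ • ContinuousLinearMap.id ℂ bidiscAlgebra - weightedRotation α₁ α₂ w) := by
  -- Freeness at `t` extends to a neighbourhood disjoint from its proper translates, so functionals
  -- attached to different zeros there do not interfere.
  have hdisj : ∀ᶠ x : closedBidisc × closedBidisc in 𝓝 (t, t), ∀ k ∈ Finset.Ioo 0 m,
      (rotation α₁ α₂)^[k] x.1 ≠ x.2 := by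
    rw [Filter.eventually_all_finset]
    intro k hk
    obtain ⟨hk0, hk⟩ := Finset.mem_Ioo.1 hk
    exact (isOpen_ne_fun ((continuous_rotation_iterate k).comp continuous_fst)
      continuous_snd).mem_nhds (hfree t ht.2.1 ht.2.2 k hk0 hk)
  rw [nhds_prod_eq] at hdisj
  obtain ⟨N, hN, hNd⟩ := eventually_prod_self_iff
    (r := fun x y => ∀ k ∈ Finset.Ioo 0 m, (rotation α₁ α₂)^[k] x ≠ y).1 hdisj
  obtain ⟨V, hVN, hV, htV⟩ := mem_nhds_iff.1 hN
  refine not_finiteDimensional_quotient _ (infinite_zeros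
    (f := characteristicFunction α₁ α₂ w μ m) hV htV ht.1
    (by rw [characteristicFunction_apply, hμ, sub_self])) hm
    (fun k => (rotation α₁ α₂)^[k])
    (fun k s => μ ^ (m - 1 - k) * weightProduct (rotation α₁ α₂) w.1 k s) (fun _ _ => rfl)
    (fun s _ => by simp [weightProduct, hμ0])
    (fun k hk hk0 s hs hs' =>
      hNd _ (hVN hs.1) _ (hVN hs'.1) k (Finset.mem_Ioo.2 ⟨hk0, hk⟩) rfl) ?_
  rintro s ⟨-, hs0⟩ _ ⟨f, rfl⟩
  rw [← cofactor_apply]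
  refine (congrArg (fun g : bidiscAlgebra => g.1 s) (cofactor_apply_sub w hΦ μ f)).trans ?_
  change (characteristicFunction α₁ α₂ w μ m).1 s * f.1 s = 0
  rw [hs0, zero_mul]

theorem not_isLowerSemiFredholm (hm : 0 < m) (hΦ : ∀ z, (rotation α₁ α₂)^[m] z = z)
    (hfree : ∀ z : closedBidisc, z.1.1 ≠ 0 → z.1.2 ≠ 0 → ∀ k, 0 < k → k < m →
      (rotation α₁ α₂)^[k] z ≠ z)
    {μ : ℂ} {t : closedBidisc} (hμ : μ ^ m = weightProduct (rotation α₁ α₂) w.1 m t) :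
    ¬ IsLowerSemiFredholm
      (μ • ContinuousLinearMap.id ℂ bidiscAlgebra - weightedRotation α₁ α₂ w) := by
  intro hS
  have hev := ((continuous_smul_id_sub (weightedRotation α₁ α₂ w)).tendsto μ).eventually hS.eventually
  have : NeZero m := ⟨hm.ne'⟩
  -- As `ν ↦ ν ^ m` is open, values of `w_m` near `w_m t` are `m`-th powers of parameters `ν` at
  -- which the operator is still lower semi-Fredholm.
  have himage := (Complex.isOpenQuotientMap_pow m).isOpenMap.image_mem_nhds hev
  simp only [hμ] at himage
  have hnear := (continuous_weightProduct α₁ α₂ w m).continuousAt.eventually himage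
  by_cases hfr : ∀ᶠ s in 𝓝 t, s ∈ puncturedBidisc →
      weightProduct (rotation α₁ α₂) w.1 m s = 0
  · have ht0 : weightProduct (rotation α₁ α₂) w.1 m t = 0 := by
      have hcl : IsClosed {s | weightProduct (rotation α₁ α₂) w.1 m s = 0} :=
        isClosed_eq (continuous_weightProduct α₁ α₂ w m) continuous_const
      exact hcl.mem_of_frequently_of_tendsto
        (((mem_closure_iff_frequently.1 (dense_puncturedBidisc t)).and_eventually hfr).mono
          fun s hs => hs.2 hs.1) tendsto_id
    rw [ht0] at hμ
    obtain rfl := pow_eq_zero_iff hm.ne' |>.1 hμ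
    exact not_isLowerSemiFredholm_of_infinite_zeros w (infinite_zeros_of_eventually w hfr) hS
  -- The point `s` lies in the punctured bidisc with `w_m s ≠ 0`, which forces `ν ≠ 0`.
  · obtain ⟨s, hs, ν, hν, hνs⟩ := ((not_eventually.1 hfr).and_eventually hnear).exists
    rw [Classical.not_imp] at hs
    refine not_isLowerSemiFredholm_of_mem_puncturedBidisc w hm hΦ hfree ?_ hs.1 hνs hν
    rintro rfl
    exact hs.2 (hνs.symm.trans (zero_pow hm.ne'))

end WeightedRotation

/-! ### Consequences of lower bounds and of invertibility. -/

theorem isUpperSemiFredholm_of_antilipschitzWith {X : Type*} [NormedAddCommGroup X] [NormedSpace ℂ X]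
    [CompleteSpace X] {S : X →L[ℂ] X} {K : NNReal} (h : AntilipschitzWith K S) :
    IsUpperSemiFredholm S := by
  refine ⟨h.isClosed_range S.uniformContinuous, ?_⟩
  rw [LinearMap.ker_eq_bot.2 h.injective]
  infer_instance

theorem notMem_approxPointSpectrum {X : Type*} [NormedAddCommGroup X] [NormedSpace ℂ X]
    {T : X →L[ℂ] X} {μ : ℂ} {K : NNReal}
    (h : AntilipschitzWith K (μ • ContinuousLinearMap.id ℂ X - T)) :
    μ ∉ approxPointSpectrum T := by
  rintro ⟨x, hx, hlim⟩
  have h1 := hlim.norm.const_mul (K : ℝ)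
  rw [norm_zero, mul_zero] at h1
  refine absurd (ge_of_tendsto' h1 fun n => ?_) (not_le.2 one_pos)
  have h2 := h.le_mul_dist (x n) 0
  rw [map_zero, dist_zero_right, dist_zero_right, hx] at h2
  rw [norm_sub_rev]
  exact h2

theorem isLowerSemiFredholm_of_isUnit {X : Type*} [NormedAddCommGroup X] [NormedSpace ℂ X]
    {S : X →L[ℂ] X} (h : IsUnit S) : IsLowerSemiFredholm S := by
  obtain ⟨R, hR⟩ := h.exists_right_inv
  have htop : S.range = ⊤ :=
    LinearMap.range_eq_top.2 fun x => ⟨R x, DFunLike.congr_fun hR x⟩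
  rw [IsLowerSemiFredholm, htop]
  infer_instance

end Bidisc

end

/-! ### Identification of the four spectra. -/

open Bidisc in
theorem mainTheorem11 (α₁ α₂ : Circle) (p q : ℕ) (hp : 0 < p) (hq : 0 < q)
    (hα₁ : IsPrimitiveRoot (α₁ : ℂ) p) (hα₂ : IsPrimitiveRoot (α₂ : ℂ) q)
    (w : Bidisc.bidiscAlgebra) :
    (spectrum ℂ (Bidisc.weightedRotation α₁ α₂ w) =
        Bidisc.lowerSemiFredholmSpectrum (Bidisc.weightedRotation α₁ α₂ w) ∧
      Bidisc.lowerSemiFredholmSpectrum (Bidisc.weightedRotation α₁ α₂ w) =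
        {μ : ℂ | ∃ t : Bidisc.closedBidisc,
          μ ^ Nat.lcm p q =
            Bidisc.weightProduct (Bidisc.rotation α₁ α₂) w.1 (Nat.lcm p q) t}) ∧
    (Bidisc.approxPointSpectrum (Bidisc.weightedRotation α₁ α₂ w) =
        Bidisc.semiFredholmSpectrum (Bidisc.weightedRotation α₁ α₂ w) ∧
      Bidisc.semiFredholmSpectrum (Bidisc.weightedRotation α₁ α₂ w) =
        {μ : ℂ | ∃ t ∈ Bidisc.torus,
          μ ^ Nat.lcm p q =
            Bidisc.weightProduct (Bidisc.rotation α₁ α₂) w.1 (Nat.lcm p q) t}) := by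
  have hm : 0 < Nat.lcm p q := Nat.lcm_pos hp hq
  have hΦ := rotation_iterate_lcm hα₁ hα₂
  have hfree : ∀ z : closedBidisc, z.1.1 ≠ 0 → z.1.2 ≠ 0 → ∀ k, 0 < k → k < p.lcm q →
      (rotation α₁ α₂)^[k] z ≠ z :=
    fun z h1 h2 k hk0 hk => rotation_iterate_ne hα₁ hα₂ h1 h2 hk0 hk
  have hspec : ∀ μ : ℂ, μ ∈ spectrum ℂ (weightedRotation α₁ α₂ w) ↔ ¬ IsUnit
      (μ • ContinuousLinearMap.id ℂ bidiscAlgebra - weightedRotation α₁ α₂ w) := fun _ => Iff.rfl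
  have hlower : lowerSemiFredholmSpectrum (weightedRotation α₁ α₂ w) = {μ : ℂ | ∃ t,
      μ ^ Nat.lcm p q = weightProduct (rotation α₁ α₂) w.1 (Nat.lcm p q) t} := by
    refine Set.Subset.antisymm (fun μ hμ => ?_) fun μ ⟨t, ht⟩ =>
      not_isLowerSemiFredholm w hm hΦ hfree ht
    by_contra h
    exact hμ (isLowerSemiFredholm_of_isUnit
      (isUnit_sub_weightedRotation w hΦ μ fun t ht => h ⟨t, ht⟩))
  have hsemi : semiFredholmSpectrum (weightedRotation α₁ α₂ w) = {μ : ℂ | ∃ t ∈ torus,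
      μ ^ Nat.lcm p q = weightProduct (rotation α₁ α₂) w.1 (Nat.lcm p q) t} := by
    refine Set.Subset.antisymm (fun μ hμ => ?_) fun μ ⟨t, ht, hμ⟩ => ?_
    · by_contra h
      obtain ⟨K, hK⟩ := exists_antilipschitz_sub_weightedRotation w hΦ μ
        fun t ht h' => h ⟨t, ht, h'⟩
      exact hμ (Or.inl (isUpperSemiFredholm_of_antilipschitzWith hK))
    · obtain ⟨f, hf⟩ := exists_isSingularSequence w hm hΦ hfree ht hμ
      exact not_or.2 ⟨hf.not_isUpperSemiFredholm, not_isLowerSemiFredholm w hm hΦ hfree hμ⟩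
  refine ⟨⟨Set.Subset.antisymm ?_ ?_, hlower⟩, ?_, hsemi⟩
  · rw [hlower]
    intro μ hμ
    by_contra h
    exact (hspec μ).1 hμ (isUnit_sub_weightedRotation w hΦ μ fun t ht => h ⟨t, ht⟩)
  · exact fun μ hμ => (hspec μ).2 fun h => hμ (isLowerSemiFredholm_of_isUnit h)
  · rw [hsemi]
    refine Set.Subset.antisymm (fun μ hμ => ?_) fun μ ⟨t, ht, hμ⟩ => ?_
    · by_contra h
      obtain ⟨K, hK⟩ := exists_antilipschitz_sub_weightedRotation w hΦ μ
        fun t ht h' => h ⟨t, ht, h'⟩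
      exact notMem_approxPointSpectrum hK hμ
    · obtain ⟨f, hf⟩ := exists_isSingularSequence w hm hΦ hfree ht hμ
      exact hf.mem_approxPointSpectrum
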